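/- Let $K$ be a field of characteristic $0$, and fix integers $\mu\ge 0$ and $k_1,\dots,k_\mu\ge 0$. Let $\mathfrak m=\bigoplus_{i=1}^{\mu}\mathfrak m_{-i}$ be a graded $K$-vector space with a fixed homogeneous basis, $\dim\mathfrak m_{-i}=k_i$ (and $\mathfrak m_{-i}=0$ for $i>\mu$). Let $M(k_1,\dots,k_\mu)$ be the set of all graded Lie algebra structures on $\mathfrak m$, i.e. brackets with $[\mathfrak m_{-i},\mathfrak m_{-j}]\subset\mathfrak m_{-i-j}$ (they are automatically nilpotent), regarded as a subset of the affine space of structure constants. Let $MF(k_1,\dots,k_\mu)\subset M(k_1,\dots,k_\mu)$ be the subset of fundamental Lie algebras, i.e. those with $[\mathfrak m_{-1},\mathfrak m_{-i}]=\mathfrak m_{-i-1}$ for all $i\ge 1$. The Tanaka prolongation of $\mathfrak m$ is the graded space $\mathfrak g(\mathfrak m)=\mathfrak m\oplus\bigoplus_{n\ge 0}\mathfrak g_n(\mathfrak m)$ with $\mathfrak g_{i}(\mathfrak m)=\mathfrak m_{i}$ for $i<0$ and, inductively for $n\ge0$, $$\mathfrak g_n(\mathfrak m)=\Big\{\varphi\colon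 \mathfrak m\to\bigoplus_{i<n}\mathfrak g_i(\mathfrak m)\ \text{linear}\ \Big|\ \varphi(\mathfrak m_{-i})\subset\mathfrak g_{n-i}(\mathfrak m)\ \ (i\ge1),\quad \varphi([x,y])=[\varphi(x),y]+[x,\varphi(y)]\ \ \forall x,y\in\mathfrak m\Big\},$$ where $[\varphi,x]=-[x,\varphi]=\varphi(x)$ for $\varphi\in\mathfrak g_n(\mathfrak m)$, $n\ge 0$, $x\in\mathfrak m$. The Lie algebra $\mathfrak m$ is of infinite type if $\dim_K\mathfrak g(\mathfrak m)=\infty$. Let $MF^\infty(k_1,\dots,k_\mu)$ be the set of all elements of $MF(k_1,\dots,k_\mu)$ of infinite type. Then $MF^\infty(k_1,\dots,k_\mu)$ is a Zariski-closed subset of $MF(k_1,\dots,k_\mu)$: there is an ideal $I$ of polynomials over $K$ in the structure constants such that $MF^\infty(k_1,\dots,k_\mu)$ is the set of points of $MF(k_1,\dots,k_\mu)$ at which all elements of $I$ vanish. -/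

import Mathlib

open scoped DirectSum

universe u v

/-! ## The Tanaka prolongation of a negatively graded Lie algebra

Throughout, a grading of a Lie algebra `m` is a family `grad : ℤ → Submodule K m`, where
`grad j` is the homogeneous component of degree `j`. For a negatively graded Lie algebra
`grad j = ⊥` for `0 ≤ j`. -/

/-- The data available after finitely many steps of the construction of the Tanaka
prolongation: the space `carrier`, standing for the sum of the components `g_i` built so far
(those with `i < n`, including all `i < 0`), the brackets `(x, X) ↦ [x, X]` of elements
`x ∈ m` with elements `X` of that space, and the homogeneous components of that space. -/
structure TanakaStage (K : Type u) (m : Type v) [Field K] [LieRing m] [LieAlgebra K m] where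
  carrier : Type v
  [addCommGroup : AddCommGroup carrier]
  [module : Module K carrier]
  act : m →ₗ[K] carrier →ₗ[K] carrier
  deg : ℤ → Submodule K carrier

attribute [instance] TanakaStage.addCommGroup TanakaStage.module

namespace TanakaStage

variable {K : Type u} {m : Type v} [Field K] [LieRing m] [LieAlgebra K m]

/-- The component of degree `n` of the prolongation, given the sum `P` of the components of
degree `< n`: all linear maps `φ : m → P` with `φ (m_i) ⊆ P_{n + i}` for all `i` and
`φ [x, y] = [φ x, y] + [x, φ y]`, where `[φ x, y] = - [y, φ x]`. -/
def component (grad : ℤ → Submodule K m) (P : TanakaStage K m) (n : ℕ) :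
    Submodule K (m →ₗ[K] P.carrier) where
  carrier := {φ | (∀ i : ℤ, ∀ x ∈ grad i, φ x ∈ P.deg (n + i)) ∧
    ∀ x y : m, φ ⁅x, y⁆ = - P.act y (φ x) + P.act x (φ y)}
  zero_mem' := ⟨fun i x _ => (P.deg (n + i)).zero_mem, fun x y => by simp⟩
  add_mem' := by
    rintro φ ψ ⟨h1, h2⟩ ⟨h3, h4⟩
    refine ⟨fun i x hx => (P.deg (n + i)).add_mem (h1 i x hx) (h3 i x hx), fun x y => ?_⟩
    simp only [LinearMap.add_apply, h2, h4, map_add]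
    abel
  smul_mem' := by
    rintro a φ ⟨h1, h2⟩
    refine ⟨fun i x hx => (P.deg (n + i)).smul_mem a (h1 i x hx), fun x y => ?_⟩
    simp only [LinearMap.smul_apply, h2, map_smul, smul_add, smul_neg]

/-- The brackets of `m` with `P ⊕ g_n`: on `P` they are the given ones, and
`[x, φ] = - φ x` for `φ ∈ g_n`. -/
def nextAct (grad : ℤ → Submodule K m) (P : TanakaStage K m) (n : ℕ) :
    m →ₗ[K] (P.carrier × P.component grad n) →ₗ[K] (P.carrier × P.component grad n) :=
  LinearMap.mk₂ K (fun x X => (P.act x X.1 - X.2.1 x, 0))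
    (fun x y X => by
      ext <;> simp
      abel)
    (fun a x X => by ext <;> simp [smul_sub])
    (fun x X Y => by
      ext <;> simp
      abel)
    (fun a x X => by ext <;> simp [smul_sub])

/-- From the sum `P` of the components of degree `< n` to the sum `P ⊕ g_n` of the components
of degree `< n + 1`; the component of degree `n` is `g_n`, the others are those of `P`. -/
def next (grad : ℤ → Submodule K m) (P : TanakaStage K m) (n : ℕ) : TanakaStage K m where
  carrier := P.carrier × P.component grad n
  act := P.nextAct grad n
  deg j := if j = n then Submodule.prod ⊥ ⊤ else Submodule.prod (P.deg j) ⊥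

end TanakaStage

section Tanaka

variable (K : Type u) {m : Type v} [Field K] [LieRing m] [LieAlgebra K m]

/-- The sum of the components of degree `< n` of the Tanaka prolongation; for `n = 0` it is
`m` itself, with its own bracket and grading. -/
def tanakaStage (grad : ℤ → Submodule K m) : ℕ → TanakaStage K m
  | 0 =>
    { carrier := m
      act := (LieModule.toEnd K m m : m →ₗ[K] Module.End K m)
      deg := grad }
  | n + 1 => (tanakaStage grad n).next grad n

/-- The component `g_n(m)`, `n ≥ 0`, of the Tanaka prolongation. -/
abbrev tanakaComponent (grad : ℤ → Submodule K m) (n : ℕ) :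
    Submodule K (m →ₗ[K] (tanakaStage K grad n).carrier) :=
  (tanakaStage K grad n).component grad n

/-- The underlying vector space of the Tanaka prolongation
`g(m) = m ⊕ g_0(m) ⊕ g_1(m) ⊕ ⋯`. -/
abbrev TanakaProlongation (grad : ℤ → Submodule K m) : Type v :=
  m × (⨁ n : ℕ, tanakaComponent K grad n)

/-- A negatively graded Lie algebra is of infinite type if its Tanaka prolongation is
infinite-dimensional. -/
def IsOfInfiniteType (grad : ℤ → Submodule K m) : Prop :=
  ¬ FiniteDimensional K (TanakaProlongation K grad)

/-- A negatively graded Lie algebra is fundamental if `[m_{-1}, m_{-i}] = m_{-i-1}` for all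
`i ≥ 1` (so that it is generated by `m_{-1}`). -/
def IsFundamental (grad : ℤ → Submodule K m) : Prop :=
  ∀ i : ℕ, 1 ≤ i →
    Submodule.span K {z : m | ∃ x ∈ grad (-1), ∃ y ∈ grad (-(i : ℤ)), ⁅x, y⁆ = z} =
      grad (-(i : ℤ) - 1)

end Tanaka

/-! ## The variety of graded nilpotent Lie algebras with given dimensions -/

/-- The index set of a homogeneous basis of a graded vector space
`m_{-1} ⊕ ⋯ ⊕ m_{-μ}` with `dim m_{-i} = k_i`. The dimension `k_i` is `k (i - 1)` here. -/
abbrev BasisIndex {μ : ℕ} (k : Fin μ → ℕ) : Type := Σ i : Fin μ, Fin (k i)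

/-- The degree of a basis vector. -/
def BasisIndex.degree {μ : ℕ} {k : Fin μ → ℕ} (p : BasisIndex k) : ℤ := -((p.1 : ℕ) + 1 : ℤ)

/-- The coordinates `(p, q, r)` of the affine space of structure constants `c (p, q, r)`. -/
abbrev Coord {μ : ℕ} (k : Fin μ → ℕ) : Type := BasisIndex k × BasisIndex k × BasisIndex k

section Variety

variable {K : Type u} [Field K] {μ : ℕ} {k : Fin μ → ℕ}

/-- The bilinear product with structure constants `c`: `[e_p, e_q] = ∑ r, c (p, q, r) e_r`. -/
def structureBracket (c : Coord k → K) (x y : BasisIndex k → K) : BasisIndex k → K :=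
  fun r => ∑ p, ∑ q, c (p, q, r) * x p * y q

variable (K k) in
/-- `M(k_1, …, k_μ)`: the structure constants of graded Lie algebra structures on
`m_{-1} ⊕ ⋯ ⊕ m_{-μ}` with `dim m_{-i} = k_i` (such a Lie algebra is nilpotent). -/
def gnlaVariety : Set (Coord k → K) :=
  {c | (∀ p q r, c (p, q, r) ≠ 0 → r.degree = p.degree + q.degree) ∧
    (∀ x, structureBracket c x x = 0) ∧
    ∀ x y z, structureBracket c x (structureBracket c y z) +
      structureBracket c y (structureBracket c z x) +
      structureBracket c z (structureBracket c x y) = 0}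

theorem structureBracket_add_left (c : Coord k → K) (x y z : BasisIndex k → K) :
    structureBracket c (x + y) z = structureBracket c x z + structureBracket c y z := by
  ext r
  simp only [structureBracket, Pi.add_apply, ← Finset.sum_add_distrib]
  exact Finset.sum_congr rfl fun p _ => Finset.sum_congr rfl fun q _ => by ring

theorem structureBracket_add_right (c : Coord k → K) (x y z : BasisIndex k → K) :
    structureBracket c x (y + z) = structureBracket c x y + structureBracket c x z := by
  ext r
  simp only [structureBracket, Pi.add_apply, ← Finset.sum_add_distrib]
  exact Finset.sum_congr rfl fun p _ => Finset.sum_congr rfl fun q _ => by ring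

theorem structureBracket_smul_right (c : Coord k → K) (a : K) (x y : BasisIndex k → K) :
    structureBracket c x (a • y) = a • structureBracket c x y := by
  ext r
  simp only [structureBracket, Pi.smul_apply, smul_eq_mul, Finset.mul_sum]
  exact Finset.sum_congr rfl fun p _ => Finset.sum_congr rfl fun q _ => by ring

theorem structureBracket_neg_right (c : Coord k → K) (x y : BasisIndex k → K) :
    structureBracket c x (-y) = -structureBracket c x y := by
  simpa using structureBracket_smul_right c (-1) x y

theorem structureBracket_skew {c : Coord k → K} (hc : c ∈ gnlaVariety K k)
    (x y : BasisIndex k → K) : structureBracket c y x = -structureBracket c x y := by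
  have h := hc.2.1 (x + y)
  rw [structureBracket_add_left, structureBracket_add_right, structureBracket_add_right,
    hc.2.1 x, hc.2.1 y, zero_add, add_zero] at h
  exact eq_neg_of_add_eq_zero_right h

theorem structureBracket_leibniz {c : Coord k → K} (hc : c ∈ gnlaVariety K k)
    (x y z : BasisIndex k → K) : structureBracket c x (structureBracket c y z) =
      structureBracket c (structureBracket c x y) z +
        structureBracket c y (structureBracket c x z) := by
  have h := hc.2.2 x y z
  rw [structureBracket_skew hc x z, structureBracket_neg_right,
    structureBracket_skew hc (structureBracket c x y) z] at h
  rw [← sub_eq_zero, ← h]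
  abel

/-- The Lie algebra with structure constants `c`, on the space of coordinate vectors. -/
def LieAlgebraOf (_c : gnlaVariety K k) : Type u := BasisIndex k → K

namespace LieAlgebraOf

variable (c : gnlaVariety K k)

instance : AddCommGroup (LieAlgebraOf c) := inferInstanceAs (AddCommGroup (BasisIndex k → K))

instance : Module K (LieAlgebraOf c) := inferInstanceAs (Module K (BasisIndex k → K))

instance : Bracket (LieAlgebraOf c) (LieAlgebraOf c) := ⟨structureBracket c.1⟩

instance : LieRing (LieAlgebraOf c) where
  add_lie := structureBracket_add_left c.1
  lie_add := structureBracket_add_right c.1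
  lie_self := c.2.2.1
  leibniz_lie := structureBracket_leibniz c.2

instance : LieAlgebra K (LieAlgebraOf c) where
  lie_smul := structureBracket_smul_right c.1

/-- The homogeneous component of degree `j`: the span of the basis vectors of degree `j`. -/
def grad (j : ℤ) : Submodule K (LieAlgebraOf c) where
  carrier := {x | ∀ p : BasisIndex k, p.degree ≠ j → (x : BasisIndex k → K) p = 0}
  zero_mem' := fun _ _ => rfl
  add_mem' := fun {x y} hx hy p hp => by
    change (x : BasisIndex k → K) p + (y : BasisIndex k → K) p = 0
    rw [hx p hp, hy p hp, add_zero]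
  smul_mem' := fun a x hx p hp => by
    change a * (x : BasisIndex k → K) p = 0
    rw [hx p hp, mul_zero]

end LieAlgebraOf

variable (K k) in
/-- `MF(k_1, …, k_μ)`: the fundamental graded Lie algebras in `M(k_1, …, k_μ)`. -/
def fundamentalSet : Set (Coord k → K) :=
  {c | ∃ hc : c ∈ gnlaVariety K k, IsFundamental K (LieAlgebraOf.grad ⟨c, hc⟩)}

variable (K k) in
/-- `MF^∞(k_1, …, k_μ)`: the fundamental graded Lie algebras of infinite type. -/
def fundamentalInfiniteSet : Set (Coord k → K) :=
  {c | ∃ hc : c ∈ gnlaVariety K k, IsFundamental K (LieAlgebraOf.grad ⟨c, hc⟩) ∧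
    IsOfInfiniteType K (LieAlgebraOf.grad ⟨c, hc⟩)}

/-- `Y` is a closed subset of `X` in the Zariski topology induced from the affine space
`σ → K`: it is cut out in `X` by polynomial equations. -/
def IsZariskiClosedIn {σ : Type} (Y X : Set (σ → K)) : Prop :=
  ∃ I : Ideal (MvPolynomial σ K), Y = X ∩ MvPolynomial.zeroLocus K I

end Variety

/-!
A fundamental graded Lie algebra `m` is generated by `m_{-1}`, so `g_n(m) = 0` forces
`g_{n+1}(m) = 0`. Each `g_n(m)` is finite-dimensional, hence `m` is of infinite type if and only if
`g_n(m) ≠ 0` for every `n` (`isOfInfiniteType_iff`), and it suffices to show that each of these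
conditions is Zariski-closed in the structure constants `c`.

For fixed `n`, all the spaces `m_c ⊕ g_0(m_c) ⊕ ⋯ ⊕ g_{n-1}(m_c)` embed in one finite-dimensional
space `A_n`, where `A_0` is the space `V` of coordinate vectors and `A_{n+1} = A_n ⊕ Hom(V, A_n)`.
The conditions that define `g_n(m_c)` inside `Hom(V, A_n)` are linear with coefficients polynomial
in `c` (`PolynomialModel`, `tanakaModel`). The common kernel of a family of linear functionals
on a space of dimension `d` is nonzero if and only if all `d × d` determinants formed from them
vanish, so `g_n(m_c) ≠ 0` is expressed by polynomial equations in `c`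
(`IsPolynomialFamily.exists_ideal`). The sum over `n` of the ideals obtained cuts out the locus of
infinite type.
-/

/-! ### Infinite type in terms of the components of the prolongation -/

section InfiniteType

variable {K : Type u} {m : Type v} [Field K] [LieRing m] [LieAlgebra K m]

theorem finiteDimensional_tanakaStage [FiniteDimensional K m] (grad : ℤ → Submodule K m) (n : ℕ) :
    FiniteDimensional K (tanakaStage K grad n).carrier := by
  induction n with
  | zero => exact ‹FiniteDimensional K m›
  | succ n ih =>
    exact inferInstanceAs (FiniteDimensional K
      ((tanakaStage K grad n).carrier × tanakaComponent K grad n))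

/-- An element of `g_{n+1}` maps `m_{-1}` to `g_n`. If `g_n = 0`, its kernel contains `m_{-1}` and
is closed under brackets, so it is everything. -/
theorem tanakaComponent_succ_eq_bot {grad : ℤ → Submodule K m}
    (hgrad : ⨆ i : ℕ, grad (-(i : ℤ) - 1) = ⊤) (hf : IsFundamental K grad) {n : ℕ}
    (hn : tanakaComponent K grad n = ⊥) :
    tanakaComponent K grad (n + 1) = ⊥ := by
  rw [Submodule.eq_bot_iff]
  rintro φ ⟨hdeg, hder⟩
  have h1 : ∀ x ∈ grad (-1), φ x = 0 := by
    intro x hx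
    have h := hdeg _ x hx
    rw [show ((n + 1 : ℕ) : ℤ) + -1 = n by push_cast; ring] at h
    change φ x ∈ (if (n : ℤ) = n then Submodule.prod ⊥ ⊤ else _) at h
    rw [if_pos rfl] at h
    exact Prod.ext h.1 (Subtype.ext ((Submodule.eq_bot_iff _).1 hn _ (φ x).2.2))
  have key (i : ℕ) : grad (-(i : ℤ) - 1) ≤ LinearMap.ker φ := by
    induction i with
    | zero => exact h1
    | succ i ih =>
      rw [← hf (i + 1) (by omega), Submodule.span_le]
      rintro _ ⟨x, hx, y, hy, rfl⟩
      rw [show -((i + 1 : ℕ) : ℤ) = -(i : ℤ) - 1 by push_cast; ring] at hy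
      have hy' : φ y = 0 := ih hy
      change φ ⁅x, y⁆ = 0
      rw [hder, h1 x hx, hy', map_zero, map_zero, neg_zero, add_zero]
  have h : ⊤ ≤ LinearMap.ker φ := hgrad ▸ iSup_le key
  exact LinearMap.ker_eq_top.1 (top_le_iff.1 h)

theorem finite_directSum_of_subsingleton {M : ℕ → Type*} [∀ n, AddCommGroup (M n)]
    [∀ n, Module K (M n)] [∀ n, Module.Finite K (M n)] (N : ℕ) (h : ∀ n, Subsingleton (M (N + n))) :
    Module.Finite K (⨁ n, M n) := by
  let f : (⨁ n, M n) →ₗ[K] ∀ i : Fin N, M i := LinearMap.pi fun i => DirectSum.component K ℕ _ i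
  refine Module.Finite.of_injective f fun x y hxy => DFinsupp.ext fun n => ?_
  by_cases hn : n < N
  · exact congrFun hxy ⟨n, hn⟩
  · obtain ⟨j, rfl⟩ := Nat.exists_eq_add_of_le (not_lt.1 hn)
    exact Subsingleton.elim _ _

theorem not_finite_directSum {M : ℕ → Type*} [∀ n, AddCommGroup (M n)] [∀ n, Module K (M n)]
    [∀ n, Nontrivial (M n)] : ¬ Module.Finite K (⨁ n, M n) := by
  intro hfd
  choose v hv using fun n => exists_ne (0 : M n)
  have hli : LinearIndependent K fun n => DirectSum.lof K ℕ M n (v n) := by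
    rw [linearIndependent_iff'ₛ]
    intro s f g hfg i hi
    have h1 := congrArg (DirectSum.component K ℕ M i) hfg
    have h2 (g : ℕ → K) : DirectSum.component K ℕ M i
        (∑ j ∈ s, g j • DirectSum.lof K ℕ M j (v j)) = g i • v i := by
      rw [map_sum, Finset.sum_eq_single_of_mem i hi, map_smul, DirectSum.component.lof_self]
      intro j _ hj
      rw [map_smul, DirectSum.component.of, dif_neg hj, smul_zero]
    rw [h2, h2] at h1
    exact smul_left_injective K (hv i) h1
  exact not_finite_iff_infinite.2 inferInstance hli.finite

theorem isOfInfiniteType_iff [FiniteDimensional K m] {grad : ℤ → Submodule K m}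
    (hgrad : ⨆ i : ℕ, grad (-(i : ℤ) - 1) = ⊤) (hf : IsFundamental K grad) :
    IsOfInfiniteType K grad ↔ ∀ n, tanakaComponent K grad n ≠ ⊥ := by
  have hfin (n : ℕ) := finiteDimensional_tanakaStage grad n
  constructor
  · intro h N hN
    apply h
    have hbot (n : ℕ) : tanakaComponent K grad (N + n) = ⊥ := by
      induction n with
      | zero => exact hN
      | succ n ih => exact tanakaComponent_succ_eq_bot hgrad hf ih
    have := finite_directSum_of_subsingleton (K := K) (M := fun n => tanakaComponent K grad n) N
      fun n => (Submodule.subsingleton_iff_eq_bot).2 (hbot n)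
    exact Module.Finite.prod
  · intro h hfd
    have (n : ℕ) : Nontrivial (tanakaComponent K grad n) :=
      Submodule.nontrivial_iff_ne_bot.2 (h n)
    exact not_finite_directSum (K := K) (M := fun n => tanakaComponent K grad n)
      (Module.Finite.of_surjective (LinearMap.snd K m _) LinearMap.snd_surjective)

end InfiniteType

/-! ### Subspaces cut out by linear equations with polynomial coefficients -/

section Regular

variable {K : Type u} [Field K] {σ : Type*} {X : Set (σ → K)}

/-- The functions on a set of points of affine space that are restrictions of polynomials. -/
noncomputable def regularFunctions (X : Set (σ → K)) : Subalgebra K (X → K) :=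
  (AlgHom.pi fun c : X => MvPolynomial.aeval c.1 : MvPolynomial σ K →ₐ[K] X → K).range

theorem mem_regularFunctions {f : X → K} :
    f ∈ regularFunctions X ↔ ∃ p : MvPolynomial σ K, ∀ c : X, MvPolynomial.aeval c.1 p = f c := by
  simp [regularFunctions, funext_iff]

variable {W W' : Type*} [AddCommGroup W] [Module K W] [AddCommGroup W'] [Module K W']

/-- A family of vectors `w c`, `c ∈ X`, depends polynomially on `c` if its
coordinates do. -/
def IsRegularMap (w : X → W) : Prop :=
  ∀ f : Module.Dual K W, (fun c => f (w c)) ∈ regularFunctions X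

theorem isRegularMap_const (w : W) : IsRegularMap fun _ : X => w := fun f =>
  (regularFunctions X).algebraMap_mem (f w)

theorem IsRegularMap.comp {w : X → W} (hw : IsRegularMap w) (g : W →ₗ[K] W') :
    IsRegularMap fun c => g (w c) := fun f => hw (f ∘ₗ g)

theorem IsRegularMap.add {w w' : X → W} (hw : IsRegularMap w) (hw' : IsRegularMap w') :
    IsRegularMap fun c => w c + w' c := fun f => by
  simp only [map_add]
  exact (regularFunctions X).add_mem (hw f) (hw' f)

theorem IsRegularMap.sub {w w' : X → W} (hw : IsRegularMap w) (hw' : IsRegularMap w') :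
    IsRegularMap fun c => w c - w' c := fun f => by
  simp only [map_sub]
  exact (regularFunctions X).sub_mem (hw f) (hw' f)

theorem isRegularMap_pi {ι : Type*} [Finite ι] {w : X → ι → K}
    (hw : ∀ i, (fun c => w c i) ∈ regularFunctions X) : IsRegularMap w := fun f => by
  classical
  have := Fintype.ofFinite ι
  have h : (fun c => f (w c)) =
      ∑ i, (fun c => w c i) * algebraMap K (X → K) (f (Pi.single i 1)) := by
    ext c
    rw [LinearMap.pi_apply_eq_sum_univ f (w c), Finset.sum_apply]
    refine Finset.sum_congr rfl fun i _ => ?_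
    simp only [smul_eq_mul, Pi.mul_apply, Pi.algebraMap_apply, Algebra.algebraMap_self_apply]
    congr 2
    ext j
    simp [Pi.single_apply, eq_comm]
  rw [h]
  exact sum_mem fun i _ => mul_mem (hw i) (Subalgebra.algebraMap_mem _ _)

/-- A family of subspaces `S c ⊆ W`, `c ∈ X`, is polynomial if each `S c` is the common kernel
of linear functionals on `W` that depend polynomially on `c`. The functionals may be taken to be
all those which vanish on every `S c`. -/
def IsPolynomialFamily (S : X → Submodule K W) : Prop :=
  ∀ c a, (∀ ℓ : X → Module.Dual K W, (∀ b, (fun c => ℓ c b) ∈ regularFunctions X) →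
    (∀ c, S c ≤ LinearMap.ker (ℓ c)) → ℓ c a = 0) → a ∈ S c

theorem isPolynomialFamily_const (S : Submodule K W) : IsPolynomialFamily fun _ : X => S := by
  intro c a h
  by_contra ha
  obtain ⟨f, hfa, hf⟩ := Submodule.exists_le_ker_of_notMem ha
  exact hfa (h (fun _ => f) (fun b => isRegularMap_const b f) fun _ => hf)

theorem isPolynomialFamily_iInf {ι : Sort*} {S : ι → X → Submodule K W}
    (hS : ∀ i, IsPolynomialFamily (S i)) : IsPolynomialFamily fun c => ⨅ i, S i c := by
  intro c a h
  refine (Submodule.mem_iInf _).2 fun i => hS i c a fun ℓ hℓ hker => h ℓ hℓ fun c' => ?_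
  exact (iInf_le _ i).trans (hker c')

theorem IsPolynomialFamily.inf {S T : X → Submodule K W} (hS : IsPolynomialFamily S)
    (hT : IsPolynomialFamily T) : IsPolynomialFamily fun c => S c ⊓ T c := fun c a h =>
  ⟨hS c a fun ℓ hℓ hker => h ℓ hℓ fun c' => inf_le_left.trans (hker c'),
    hT c a fun ℓ hℓ hker => h ℓ hℓ fun c' => inf_le_right.trans (hker c')⟩

theorem IsPolynomialFamily.comap {S : X → Submodule K W'} (hS : IsPolynomialFamily S)
    (g : W →ₗ[K] W') : IsPolynomialFamily fun c => (S c).comap g := fun c a h =>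
  hS c (g a) fun ℓ hℓ hker => h (fun c => ℓ c ∘ₗ g) (fun b => hℓ (g b)) fun c' _ hb => hker c' hb

theorem isPolynomialFamily_ker {L : X → W →ₗ[K] W'} (hL : ∀ b, IsRegularMap fun c => L c b) :
    IsPolynomialFamily fun c => LinearMap.ker (L c) := fun c a h =>
  (Module.forall_dual_apply_eq_zero_iff K (L c a)).1 fun f =>
    h (fun c => f ∘ₗ L c) (fun b => hL b f) fun c' b hb => by
      rw [LinearMap.mem_ker] at hb ⊢
      rw [LinearMap.comp_apply, hb, map_zero]

/-- Functionals on a space of dimension `d` have a common nonzero zero if and only if any `d` of them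
have determinant zero: otherwise they span the dual space, and a basis of it chosen among them
has nonzero determinant. -/
theorem exists_ne_zero_iff_det_eq_zero [FiniteDimensional K W] (s : Set (Module.Dual K W)) :
    (∃ a ≠ 0, ∀ f ∈ s, f a = 0) ↔
      ∀ t : Fin (Module.finrank K W) → Module.Dual K W, (∀ i, t i ∈ s) →
        (Matrix.of fun i j => t i (Module.finBasis K W j)).det = 0 := by
  set b := Module.finBasis K W
  constructor
  · rintro ⟨a, ha, hs⟩ t ht
    refine Matrix.exists_mulVec_eq_zero_iff.1 ⟨b.repr a, ?_, ?_⟩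
    · intro h
      exact ha (b.repr.map_eq_zero_iff.1 (DFunLike.coe_injective h))
    · ext i
      have h := hs _ (ht i)
      rw [← b.sum_repr a, map_sum] at h
      simpa [Matrix.mulVec, dotProduct, mul_comm] using h
  · intro h
    by_contra! hne
    have htop : Submodule.span K s = ⊤ := by
      by_contra hlt
      obtain ⟨F, hF0, hF⟩ := Submodule.exists_le_ker_of_lt_top _ (lt_top_iff_ne_top.2 hlt)
      obtain ⟨a, rfl⟩ := (Module.evalEquiv K W).surjective F
      obtain ⟨f, hf, hfa⟩ := hne a (by rintro rfl; exact hF0 (map_zero _))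
      exact hfa (hF (Submodule.subset_span hf))
    let B := Module.Basis.ofSpan htop.ge
    have hB (i) : B i ∈ s := Module.Basis.ofSpan_subset htop.ge ⟨i, rfl⟩
    let B' := B.reindex (Fintype.equivOfCardEq (β := Fin (Module.finrank K W)) (by
      rw [← Module.finrank_eq_card_basis B, Subspace.dual_finrank_eq, Fintype.card_fin]))
    have hdet := h B' fun i => by
      rw [Module.Basis.reindex_apply]; exact hB _
    obtain ⟨x, hx, hx0⟩ := Matrix.exists_mulVec_eq_zero_iff.2 hdet
    -- A vector killed by the matrix of `B'` gives a vector of `W` killed by the whole dual space.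
    have hz : ∑ j, x j • b j = 0 := by
      refine (Module.forall_dual_apply_eq_zero_iff K _).1 fun f => ?_
      have hle : (⊤ : Submodule K (Module.Dual K W)) ≤
          LinearMap.ker (Module.Dual.eval K W (∑ j, x j • b j)) := by
        rw [← B'.span_eq, Submodule.span_le]
        rintro _ ⟨i, rfl⟩
        have := congrFun hx0 i
        simpa [Matrix.mulVec, dotProduct, mul_comm] using this
      exact hle (Submodule.mem_top (x := f))
    exact hx (funext (Fintype.linearIndependent_iff.1 b.linearIndependent x hz))

/-- The locus where the members of a polynomial family are nonzero is cut out by the determinants of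
the functionals that vanish on the family. -/
theorem IsPolynomialFamily.exists_ideal [FiniteDimensional K W] {S : X → Submodule K W}
    (hS : IsPolynomialFamily S) : ∃ I : Ideal (MvPolynomial σ K),
      ∀ c : X, S c ≠ ⊥ ↔ c.1 ∈ MvPolynomial.zeroLocus K I := by
  let E : Set (X → Module.Dual K W) := {ℓ | (∀ b, (fun c => ℓ c b) ∈ regularFunctions X) ∧
    ∀ c, S c ≤ LinearMap.ker (ℓ c)}
  have hmem (c : X) (a : W) : a ∈ S c ↔ ∀ f ∈ (fun ℓ : X → Module.Dual K W => ℓ c) '' E, f a = 0 :=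
    ⟨by rintro ha _ ⟨ℓ, hℓ, rfl⟩; exact hℓ.2 c ha,
      fun h => hS c a fun ℓ h1 h2 => h _ ⟨ℓ, ⟨h1, h2⟩, rfl⟩⟩
  refine ⟨Ideal.span {p | ∃ t : Fin (Module.finrank K W) → E, ∀ c : X, MvPolynomial.aeval c.1 p =
    (Matrix.of fun i j => (t i).1 c (Module.finBasis K W j)).det}, fun c => ?_⟩
  rw [MvPolynomial.zeroLocus_span, Submodule.ne_bot_iff]
  have h1 := exists_ne_zero_iff_det_eq_zero ((fun ℓ : X → Module.Dual K W => ℓ c) '' E)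
  simp only [← hmem] at h1
  rw [show (∃ x ∈ S c, x ≠ 0) ↔ ∃ x ≠ 0, x ∈ S c by simp only [and_comm], h1]
  constructor
  · rintro h p ⟨t, ht⟩
    rw [ht c]
    exact h (fun i => (t i).1 c) fun i => ⟨_, (t i).2, rfl⟩
  · intro h t ht
    choose ℓ hℓ hℓt using ht
    choose p hp using fun i j => mem_regularFunctions.1 ((hℓ i).1 (Module.finBasis K W j))
    have h2 := h (Matrix.of p).det ⟨fun i => ⟨ℓ i, hℓ i⟩, fun c' => by
      rw [AlgHom.map_det]
      congr 1
      ext i j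
      exact hp i j c'⟩
    rw [AlgHom.map_det] at h2
    rw [← h2]
    congr 1
    ext i j
    change t i _ = MvPolynomial.aeval c.1 (p i j)
    rw [hp i j c, ← hℓt]

end Regular

/-! ### Embedding the prolongations in a fixed space -/

section Models

variable {K : Type u} [Field K] {μ : ℕ} {k : Fin μ → ℕ}

/-- The identification of the Lie algebra with structure constants `c` with the space of
coordinate vectors, which does not depend on `c`. -/
def LieAlgebraOf.toCoord (c : gnlaVariety K k) : LieAlgebraOf c ≃ₗ[K] (BasisIndex k → K) :=
  LinearEquiv.refl K _

instance (c : gnlaVariety K k) : FiniteDimensional K (LieAlgebraOf c) :=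
  (LieAlgebraOf.toCoord c).symm.finiteDimensional

theorem LieAlgebraOf.toCoord_lie (c : gnlaVariety K k) (x y : LieAlgebraOf c) :
    LieAlgebraOf.toCoord c ⁅x, y⁆ =
      structureBracket c.1 (LieAlgebraOf.toCoord c x) (LieAlgebraOf.toCoord c y) :=
  rfl

theorem isPolynomialFamily_range_toCoord : IsPolynomialFamily fun c : gnlaVariety K k =>
    LinearMap.range (LieAlgebraOf.toCoord c).toLinearMap := by
  simp only [LinearEquiv.range]
  exact isPolynomialFamily_const ⊤

variable (K k) in
/-- The homogeneous component of degree `j` of the space of coordinate vectors. -/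
def coordGrad (j : ℤ) : Submodule K (BasisIndex k → K) :=
  ⨅ p : BasisIndex k, ⨅ _ : p.degree ≠ j, LinearMap.ker (LinearMap.proj p)

theorem mem_coordGrad {j : ℤ} {x : BasisIndex k → K} :
    x ∈ coordGrad K k j ↔ ∀ p : BasisIndex k, p.degree ≠ j → x p = 0 := by
  simp [coordGrad]

theorem LieAlgebraOf.toCoord_mem_coordGrad (c : gnlaVariety K k) {j : ℤ} {x : LieAlgebraOf c} :
    LieAlgebraOf.toCoord c x ∈ coordGrad K k j ↔ x ∈ LieAlgebraOf.grad c j :=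
  mem_coordGrad

theorem isRegularMap_structureBracket (x y : BasisIndex k → K) :
    IsRegularMap fun c : gnlaVariety K k => structureBracket c.1 x y := by
  refine isRegularMap_pi fun r => mem_regularFunctions.2
    ⟨∑ p, ∑ q, MvPolynomial.X (p, q, r) * MvPolynomial.C (x p) * MvPolynomial.C (y q), fun c => ?_⟩
  simp [structureBracket, map_sum]

/-- A simultaneous embedding of a family of partial prolongations `P c`, one for each graded Lie
algebra `c`, into one finite-dimensional space which does not depend on `c`: the images form a
polynomial family, the brackets with coordinate vectors extend to bilinear maps on that space
depending polynomially on `c`, and the grading is induced by a fixed one. -/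
structure PolynomialModel (P : ∀ c : gnlaVariety K k, TanakaStage K (LieAlgebraOf c)) where
  space : Type u
  [addCommGroup : AddCommGroup space]
  [module : Module K space]
  [finiteDimensional : FiniteDimensional K space]
  emb : ∀ c, (P c).carrier →ₗ[K] space
  emb_injective : ∀ c, Function.Injective (emb c)
  isPolynomialFamily_range : IsPolynomialFamily fun c => LinearMap.range (emb c)
  act : gnlaVariety K k → (BasisIndex k → K) → space →ₗ[K] space
  isRegularMap_act : ∀ x a, IsRegularMap fun c => act c x a
  emb_act : ∀ c x X, emb c ((P c).act x X) = act c (LieAlgebraOf.toCoord c x) (emb c X)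
  deg : ℤ → Submodule K space
  emb_mem_deg : ∀ c j X, emb c X ∈ deg j ↔ X ∈ (P c).deg j

namespace PolynomialModel

attribute [instance] addCommGroup module finiteDimensional

variable {P : ∀ c : gnlaVariety K k, TanakaStage K (LieAlgebraOf c)} (A : PolynomialModel P)

/-- The embedding of the component of degree `n` built on `P c` into the linear maps from
coordinate vectors to the space of the model. -/
def embComponent (n : ℕ) (c : gnlaVariety K k) :
    (P c).component (LieAlgebraOf.grad c) n →ₗ[K] (BasisIndex k → K) →ₗ[K] A.space where
  toFun φ := A.emb c ∘ₗ φ.1 ∘ₗ (LieAlgebraOf.toCoord c).symm.toLinearMap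
  map_add' _ _ := by ext; simp
  map_smul' _ _ := by ext; simp

theorem embComponent_apply (n : ℕ) (c : gnlaVariety K k)
    (φ : (P c).component (LieAlgebraOf.grad c) n) (x : LieAlgebraOf c) :
    A.embComponent n c φ (LieAlgebraOf.toCoord c x) = A.emb c (φ.1 x) :=
  rfl

theorem embComponent_injective (n : ℕ) (c : gnlaVariety K k) :
    Function.Injective (A.embComponent n c) := fun _ _ h =>
  Subtype.ext (LinearMap.ext fun x => A.emb_injective c
    (LinearMap.congr_fun h (LieAlgebraOf.toCoord c x)))

/-- The linear map whose vanishing at `φ` says that `φ` is compatible with the bracket of `x` and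
`y`. -/
def derivationDefect (c : gnlaVariety K k) (x y : BasisIndex k → K) :
    ((BasisIndex k → K) →ₗ[K] A.space) →ₗ[K] A.space :=
  LinearMap.applyₗ (structureBracket c.1 x y) + A.act c y ∘ₗ LinearMap.applyₗ x -
    A.act c x ∘ₗ LinearMap.applyₗ y

/-- The linear conditions that cut out the component of degree `n` inside the maps from coordinate
vectors to the space of the model; the first says that the values lie in the image of `P c`. -/
theorem mem_range_embComponent (n : ℕ) (c : gnlaVariety K k)
    (φ : (BasisIndex k → K) →ₗ[K] A.space) :
    φ ∈ LinearMap.range (A.embComponent n c) ↔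
      (∀ x, φ x ∈ LinearMap.range (A.emb c)) ∧
      (∀ i, ∀ x ∈ coordGrad K k i, φ x ∈ A.deg (n + i)) ∧
      ∀ x y, A.derivationDefect c x y φ = 0 := by
  constructor
  · rintro ⟨ψ, rfl⟩
    refine ⟨fun x => ⟨_, rfl⟩, fun i x hx => (A.emb_mem_deg c _ _).2
      (ψ.2.1 i _ ((LieAlgebraOf.toCoord_mem_coordGrad c).1 hx)), fun x y => ?_⟩
    obtain ⟨x, rfl⟩ := (LieAlgebraOf.toCoord c).surjective x
    obtain ⟨y, rfl⟩ := (LieAlgebraOf.toCoord c).surjective y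
    simp only [derivationDefect, LinearMap.sub_apply, LinearMap.add_apply, LinearMap.comp_apply,
      LinearMap.applyₗ_apply_apply, ← LieAlgebraOf.toCoord_lie, embComponent_apply, ← emb_act]
    rw [ψ.2.2 x y, map_add, map_neg]
    abel
  · rintro ⟨h1, h2, h3⟩
    let e := LinearEquiv.ofInjective (A.emb c) (A.emb_injective c)
    let ψ : LieAlgebraOf c →ₗ[K] (P c).carrier :=
      e.symm.toLinearMap ∘ₗ φ.codRestrict _ h1 ∘ₗ (LieAlgebraOf.toCoord c).toLinearMap
    have hψ (x : LieAlgebraOf c) : A.emb c (ψ x) = φ (LieAlgebraOf.toCoord c x) :=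
      congrArg Subtype.val (e.apply_symm_apply (φ.codRestrict _ h1 (LieAlgebraOf.toCoord c x)))
    refine ⟨⟨ψ, fun i x hx => ?_, fun x y => ?_⟩, LinearMap.ext hψ⟩
    · rw [← A.emb_mem_deg, hψ]
      exact h2 i _ ((LieAlgebraOf.toCoord_mem_coordGrad c).2 hx)
    · apply A.emb_injective c
      have h := h3 (LieAlgebraOf.toCoord c x) (LieAlgebraOf.toCoord c y)
      simp only [derivationDefect, LinearMap.sub_apply, LinearMap.add_apply, LinearMap.comp_apply,
        LinearMap.applyₗ_apply_apply, ← LieAlgebraOf.toCoord_lie] at h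
      rw [map_add, map_neg, A.emb_act, A.emb_act, hψ, hψ, hψ, ← sub_eq_zero, ← h]
      abel

theorem isPolynomialFamily_range_embComponent (n : ℕ) :
    IsPolynomialFamily fun c => LinearMap.range (A.embComponent n c) := by
  have h (c : gnlaVariety K k) : LinearMap.range (A.embComponent n c) =
      (⨅ x, (LinearMap.range (A.emb c)).comap (LinearMap.applyₗ x)) ⊓
        ((⨅ i, ⨅ x, ⨅ _ : x ∈ coordGrad K k i, (A.deg (n + i)).comap (LinearMap.applyₗ x)) ⊓
          ⨅ x, ⨅ y, LinearMap.ker (A.derivationDefect c x y)) := by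
    ext φ
    rw [mem_range_embComponent]
    simp only [Submodule.mem_inf, Submodule.mem_iInf, Submodule.mem_comap, LinearMap.mem_ker,
      LinearMap.applyₗ_apply_apply]
  simp only [h]
  refine (isPolynomialFamily_iInf fun x => A.isPolynomialFamily_range.comap _).inf
    ((isPolynomialFamily_const _).inf
      (isPolynomialFamily_iInf fun x => isPolynomialFamily_iInf fun y =>
        isPolynomialFamily_ker fun φ => ?_))
  exact (((isRegularMap_structureBracket x y).comp φ).add (A.isRegularMap_act y (φ x))).sub
    (A.isRegularMap_act x (φ y))

theorem isPolynomialFamily_range_prodMap (n : ℕ) :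
    IsPolynomialFamily fun c => LinearMap.range ((A.emb c).prodMap (A.embComponent n c)) := by
  simp only [LinearMap.range_prodMap]
  have h := A.isPolynomialFamily_range_embComponent n
  exact (A.isPolynomialFamily_range.comap
    (LinearMap.fst K A.space ((BasisIndex k → K) →ₗ[K] A.space))).inf
    (h.comap (LinearMap.snd K A.space ((BasisIndex k → K) →ₗ[K] A.space)))

/-- The model of the family `P c` gives one of the family `P c ⊕ g_n`. -/
def next (n : ℕ) : PolynomialModel fun c => (P c).next (LieAlgebraOf.grad c) n where
  space := A.space × ((BasisIndex k → K) →ₗ[K] A.space)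
  emb c := (A.emb c).prodMap (A.embComponent n c)
  emb_injective c := (A.emb_injective c).prodMap (A.embComponent_injective n c)
  isPolynomialFamily_range := A.isPolynomialFamily_range_prodMap n
  act c x := LinearMap.inl K _ _ ∘ₗ
    (A.act c x ∘ₗ LinearMap.fst K _ _ - LinearMap.applyₗ x ∘ₗ LinearMap.snd K _ _)
  isRegularMap_act x a :=
    ((A.isRegularMap_act x a.1).sub (isRegularMap_const (a.2 x))).comp
      (LinearMap.inl K A.space ((BasisIndex k → K) →ₗ[K] A.space))
  emb_act c x X := by
    refine Prod.ext ?_ ?_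
    · change A.emb c ((P c).act x X.1 - X.2.1 x) = _
      rw [map_sub, A.emb_act]
      rfl
    · exact map_zero (A.embComponent n c)
  deg j := if j = n then Submodule.prod ⊥ ⊤ else Submodule.prod (A.deg j) ⊥
  emb_mem_deg c j X := by
    change _ ↔ X ∈ (if j = n then Submodule.prod ⊥ ⊤ else Submodule.prod ((P c).deg j) ⊥)
    obtain ⟨X, φ⟩ := X
    split_ifs
    · change A.emb c X = 0 ∧ True ↔ X = 0 ∧ True
      rw [map_eq_zero_iff _ (A.emb_injective c)]
    · change A.emb c X ∈ A.deg j ∧ A.embComponent n c φ = 0 ↔ X ∈ (P c).deg j ∧ φ = 0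
      rw [map_eq_zero_iff _ (A.embComponent_injective n c), A.emb_mem_deg]

end PolynomialModel

variable (K k) in
/-- The model of the sums of the components of degree `< n` of the Tanaka prolongations. -/
def tanakaModel : ∀ n : ℕ,
    PolynomialModel fun c : gnlaVariety K k => tanakaStage K (LieAlgebraOf.grad c) n
  | 0 =>
    { space := BasisIndex k → K
      emb c := (LieAlgebraOf.toCoord c).toLinearMap
      emb_injective c := (LieAlgebraOf.toCoord c).injective
      isPolynomialFamily_range := isPolynomialFamily_range_toCoord
      act c x :=
        { toFun := structureBracket c.1 x
          map_add' := structureBracket_add_right c.1 x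
          map_smul' a := structureBracket_smul_right c.1 a x }
      isRegularMap_act := isRegularMap_structureBracket
      emb_act _ _ _ := rfl
      deg := coordGrad K k
      emb_mem_deg c _ _ := LieAlgebraOf.toCoord_mem_coordGrad c }
  | n + 1 => PolynomialModel.next (P := fun c => tanakaStage K (LieAlgebraOf.grad c) n)
      (tanakaModel n) n

/-! ### Closedness -/

theorem LieAlgebraOf.iSup_grad (c : gnlaVariety K k) :
    ⨆ i : ℕ, LieAlgebraOf.grad c (-(i : ℤ) - 1) = ⊤ := by
  classical
  refine eq_top_iff.2 fun x _ => ?_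
  have hx : x = ∑ p, (LieAlgebraOf.toCoord c).symm (Pi.single p (LieAlgebraOf.toCoord c x p)) := by
    apply (LieAlgebraOf.toCoord c).injective
    simp only [map_sum, LinearEquiv.apply_symm_apply, Finset.univ_sum_single]
  rw [hx]
  refine sum_mem fun p _ => Submodule.mem_iSup_of_mem (p.1 : ℕ) ?_
  rw [← LieAlgebraOf.toCoord_mem_coordGrad, LinearEquiv.apply_symm_apply, mem_coordGrad]
  intro q hq
  refine Pi.single_eq_of_ne ?_ _
  rintro rfl
  exact hq (by rw [BasisIndex.degree]; ring)

theorem exists_ideal_tanakaComponent_ne_bot (n : ℕ) :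
    ∃ I : Ideal (MvPolynomial (Coord k) K), ∀ c : gnlaVariety K k,
      tanakaComponent K (LieAlgebraOf.grad c) n ≠ ⊥ ↔ c.1 ∈ MvPolynomial.zeroLocus K I := by
  obtain ⟨I, hI⟩ := ((tanakaModel K k n).isPolynomialFamily_range_embComponent n).exists_ideal
  refine ⟨I, fun c => ?_⟩
  rw [← hI c, ne_eq, ne_eq, LinearMap.range_eq_bot, not_iff_not]
  constructor
  · intro h
    have : Subsingleton (tanakaComponent K (LieAlgebraOf.grad c) n) := by
      rw [h]; infer_instance
    exact Subsingleton.elim _ _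
  · intro h
    rw [Submodule.eq_bot_iff]
    intro φ hφ
    have h0 := (tanakaModel K k n).embComponent_injective n c
      (a₁ := ⟨φ, hφ⟩) (a₂ := 0) (by rw [h]; rfl)
    exact congrArg Subtype.val h0

end Models

theorem theorem2 (K : Type u) [Field K] [CharZero K] (μ : ℕ) (k : Fin μ → ℕ) :
    IsZariskiClosedIn (fundamentalInfiniteSet K k) (fundamentalSet K k) := by
  choose I hI using exists_ideal_tanakaComponent_ne_bot (K := K) (k := k)
  refine ⟨⨆ n, I n, Set.ext fun c => ?_⟩
  have hsup : c ∈ MvPolynomial.zeroLocus K (⨆ n, I n) ↔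
      ∀ n, c ∈ MvPolynomial.zeroLocus K (I n) := by
    simp only [← Set.singleton_subset_iff, MvPolynomial.le_zeroLocus_iff_le_vanishingIdeal, iSup_le_iff]
  rw [Set.mem_inter_iff, hsup]
  constructor
  · rintro ⟨hc, hf, hinf⟩
    exact ⟨⟨hc, hf⟩, fun n => (hI n ⟨c, hc⟩).1
      ((isOfInfiniteType_iff (LieAlgebraOf.iSup_grad _) hf).1 hinf n)⟩
  · rintro ⟨⟨hc, hf⟩, h⟩
    exact ⟨hc, hf, (isOfInfiniteType_iff (LieAlgebraOf.iSup_grad _) hf).2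
      fun n => (hI n ⟨c, hc⟩).2 (h n)⟩
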